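/- For complex numbers $a,q$ with $|q|<1$ let $(a;q)_\infty=\prod_{j\ge 0}(1-aq^j)$, and let $[x]$ denote the greatest integer not exceeding $x$. Then for every complex number $q$ with $|q|<1$ (with the convention $0^0=1$ when $q=0$) the following six identities hold: \begin{align*} (q;q)_\infty^2 &= \sum_{k=1}^\infty\left((-1)^{k+1}q^{\frac{k(k-1)}{2}}+\sum_{n=1}^\infty(-1)^{n+k+1}q^{\frac{k(k-1)}{2}+\frac{n(n-3)}{2}+2kn}(1+q^n)\right),\\ (q;q)_\infty^2 &= \sum_{k=1}^\infty\sum_{n=0}^\infty(-1)^{n+k+1}q^{\frac{k(k+1)}{2}+\frac{n(n-3)}{2}+2kn-1}(1-q^{2n+1}),\\ (q;q)_\infty^2(q;q^2)_\infty &= \sum_{k=1}^\infty\sum_{n=0}^\infty(-1)^{k+1}q^{\frac{k(k-1)}{2}+\frac{n(3n-1)}{2}+3kn}(1-q^{2k-1})(1-q^{k+n}),\\ (q;q)_\infty(q^2;q^2)_\infty &= \sum_{k=1}^\infty\sum_{n=0}^\infty(-1)^{k+n+1}q^{\frac{k(k+1)}{2}+n^2-n+2kn-1}(1-q^{2n+1}),\\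 (q;q)_\infty^2(q;q^2)_\infty &= \sum_{k=1}^\infty\ \sum_{n=-[(k-1)/3]}^{[k/3]}(-1)^{n+k+1}q^{\frac{k^2-k}{2}-3n^2+n}(1-q^k),\\ (q;q)_\infty(q^2;q^2)_\infty &= \sum_{k=0}^\infty\ \sum_{n=-[k/2]}^{[k/2]}(-1)^{n+k}q^{\frac{k^2+k}{2}-n^2}. \end{align*} All the infinite series converge absolutely; in the first four identities the double series over the pairs $(k,n)$ also converges absolutely. -/

import Mathlib

noncomputable section

/-- The infinite `q`-shifted factorial `(a; q)_∞ = ∏_{j ≥ 0} (1 - a q^j)`, for `|q| < 1`. -/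
def qPochInf (a q : ℂ) : ℂ := ∏' j : ℕ, (1 - a * q ^ j)

/-- For `|q| < 1` the product defining `(a; q)_∞` converges (so its value is not a default). -/
theorem multipliable_qPochInf (a q : ℂ) (hq : ‖q‖ < 1) :
    Multipliable (fun j : ℕ => 1 - a * q ^ j) := by
  have h : Summable (fun j : ℕ => ‖-(a * q ^ j)‖) := by
    simp only [norm_neg, norm_mul, norm_pow]
    exact (summable_geometric_of_lt_one (norm_nonneg q) hq).mul_left _
  simpa [sub_eq_add_neg] using multipliable_one_add_of_summable h

end

open Filter Topology Finset

/-! The engine is the Bailey transform relative to `q`: a double series over `(k, M)` is summed by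
rows and along `N = k + M`. Write `a k` for the coefficients of a Bailey pair and `w N` for a
weight. The diagonal sums see only the other half `β_N` of the pair; the row sums see only the
conjugate pair attached to `w`.

Two pairs are used: the unit pair, with `β_N` supported at `N = 0` (`sum_unit_bailey_pair`), and a
pair with `β_N = 1/(q²;q²)_N` (`sum_gaussTerm`). Two weights are used: `w = 1`, whose row sums are
partial theta series, and `w_N = (-q;q)_N`, whose row sums are false theta series. Both row sums
come from Heine's transformation, the second also from Rogers–Fine. Unit pair with `w = 1` gives
`(q;q)_∞²`; unit pair with `(-q;q)_N` gives `(q;q)_∞²(q;q²)_∞`; the other pair with `w = 1` gives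
`(q;q)_∞(q²;q²)_∞`.

The six identities are rearrangements of these three absolutely convergent double series. The
Hecke-type sums arise by expanding the factors `1 - q^m`, moving a boundary column between two
pieces, and matching the pieces with the two signs of `n`. -/

/-- The finite `q`-shifted factorial `(a; q)_n`. -/
def qPoch (a q : ℂ) (n : ℕ) : ℂ := ∏ i ∈ range n, (1 - a * q ^ i)

theorem qPoch_zero (a q : ℂ) : qPoch a q 0 = 1 := by simp [qPoch]

theorem qPoch_succ (a q : ℂ) (n : ℕ) : qPoch a q (n + 1) = qPoch a q n * (1 - a * q ^ n) := by
  simp [qPoch, prod_range_succ]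

theorem qPoch_add (a q : ℂ) (m n : ℕ) :
    qPoch a q (m + n) = qPoch a q m * qPoch (a * q ^ m) q n := by
  simp only [qPoch, prod_range_add]
  congr 1
  refine prod_congr rfl fun i _ => ?_
  rw [pow_add]; ring

theorem qPoch_succ' (a q : ℂ) (n : ℕ) : qPoch a q (n + 1) = (1 - a) * qPoch (a * q) q n := by
  rw [add_comm, qPoch_add]; simp [qPoch]

theorem one_sub_ne_zero_of_norm_lt {z : ℂ} (hz : ‖z‖ < 1) : 1 - z ≠ 0 := by
  intro h
  rw [← sub_eq_zero.mp h] at hz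
  simp at hz

theorem norm_mul_pow_lt_one {a q : ℂ} (ha : ‖a‖ < 1) (hq : ‖q‖ < 1) (n : ℕ) :
    ‖a * q ^ n‖ < 1 := by
  rw [norm_mul, norm_pow]
  exact (mul_le_of_le_one_right (norm_nonneg _) (pow_le_one₀ (norm_nonneg _) hq.le)).trans_lt ha

theorem qPoch_ne_zero {a q : ℂ} (ha : ‖a‖ < 1) (hq : ‖q‖ < 1) (n : ℕ) : qPoch a q n ≠ 0 :=
  prod_ne_zero_iff.mpr fun i _ => one_sub_ne_zero_of_norm_lt (norm_mul_pow_lt_one ha hq i)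

theorem tendsto_qPoch (a : ℂ) {q : ℂ} (hq : ‖q‖ < 1) :
    Tendsto (qPoch a q) atTop (𝓝 (qPochInf a q)) :=
  (multipliable_qPochInf a q hq).hasProd.tendsto_prod_nat

theorem qPochInf_eq_mul (a : ℂ) {q : ℂ} (hq : ‖q‖ < 1) (n : ℕ) :
    qPochInf a q = qPoch a q n * qPochInf (a * q ^ n) q := by
  have h1 : Tendsto (fun m => qPoch a q (n + m)) atTop (𝓝 (qPochInf a q)) := by
    have := (tendsto_add_atTop_iff_nat n).mpr (tendsto_qPoch a hq)
    simpa only [add_comm] using this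
  have h2 := (tendsto_qPoch (a * q ^ n) hq).const_mul (qPoch a q n)
  simp only [qPoch_add] at h1
  exact tendsto_nhds_unique h1 h2

theorem exists_norm_qPoch_le (a : ℂ) {q : ℂ} (hq : ‖q‖ < 1) : ∃ C, ∀ n, ‖qPoch a q n‖ ≤ C := by
  obtain ⟨C, hC⟩ := (Metric.isBounded_range_of_tendsto _ (tendsto_qPoch a hq)).exists_norm_le
  exact ⟨C, fun n => hC _ ⟨n, rfl⟩⟩

/-! ### The `q`-binomial theorem and Euler's expansion -/

/-- The terms of the `q`-binomial series, in homogeneous form. -/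
noncomputable def qBinomTerm (x b q : ℂ) (n : ℕ) : ℂ := (∏ i ∈ range n, (x - b * q ^ i)) / qPoch q q n

theorem qBinomTerm_succ (x b : ℂ) {q : ℂ} (hq : ‖q‖ < 1) (n : ℕ) :
    qBinomTerm x b q (n + 1) * (1 - q ^ (n + 1)) = qBinomTerm x b q n * (x - b * q ^ n) := by
  have h1 := qPoch_ne_zero hq hq n
  have h2 : 1 - q * q ^ n ≠ 0 := one_sub_ne_zero_of_norm_lt (norm_mul_pow_lt_one hq hq n)
  rw [qBinomTerm, qBinomTerm, prod_range_succ, qPoch_succ]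
  rw [pow_succ', div_mul_eq_mul_div, div_mul_eq_mul_div, mul_div_mul_right _ _ h2]

theorem summable_qBinomTerm {x q : ℂ} (b : ℂ) (hx : ‖x‖ < 1) (hq : ‖q‖ < 1) :
    Summable (qBinomTerm x b q) := by
  obtain ⟨r, hr, hr1⟩ := exists_between hx
  refine summable_of_ratio_norm_eventually_le hr1 ?_
  have hq0 := tendsto_pow_atTop_nhds_zero_of_norm_lt_one hq
  have hq1 := (tendsto_add_atTop_iff_nat 1).mpr hq0
  have h : Tendsto (fun n : ℕ => ‖(x - b * q ^ n) / (1 - q ^ (n + 1))‖) atTop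
      (𝓝 ‖(x - b * 0) / (1 - 0)‖) :=
    ((tendsto_const_nhds.sub (hq0.const_mul b)).div (tendsto_const_nhds.sub hq1) (by simp)).norm
  have h' : ‖(x - b * 0) / (1 - 0)‖ < r := by simpa using hr
  filter_upwards [h.eventually_lt_const h'] with n hn
  have h2 : 1 - q ^ (n + 1) ≠ 0 := by
    rw [pow_succ']; exact one_sub_ne_zero_of_norm_lt (norm_mul_pow_lt_one hq hq n)
  have : qBinomTerm x b q (n + 1)
      = (x - b * q ^ n) / (1 - q ^ (n + 1)) * qBinomTerm x b q n := by
    field_simp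
    rw [qBinomTerm_succ x b hq, mul_comm]
  rw [this, norm_mul]
  exact mul_le_mul_of_nonneg_right hn.le (norm_nonneg _)

theorem norm_pow_mul_le {q : ℂ} (hq : ‖q‖ < 1) (k : ℕ) (t : ℂ) : ‖q ^ k * t‖ ≤ ‖t‖ := by
  rw [norm_mul, norm_pow]
  exact mul_le_of_le_one_left (norm_nonneg _) (pow_le_one₀ (norm_nonneg _) hq.le)

/-- Weighting the term recurrence by `q^(N n)` and summing turns it into a relation between the
series at levels `N` and `N + 1`. Iterating it builds both infinite products at once. -/
theorem tsum_qBinomTerm_step {x q : ℂ} (b : ℂ) (hx : ‖x‖ < 1) (hq : ‖q‖ < 1) (N : ℕ) :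
    (1 - x * q ^ N) * ∑' n, q ^ (N * n) * qBinomTerm x b q n =
      (1 - b * q ^ N) * ∑' n, q ^ ((N + 1) * n) * qBinomTerm x b q n := by
  set t := qBinomTerm x b q with ht
  have hs := summable_qBinomTerm b hx hq
  have hS : ∀ N : ℕ, Summable fun n => q ^ (N * n) * t n := fun N =>
    .of_norm_bounded hs.norm fun n => norm_pow_mul_le hq _ _
  set F := ∑' n, q ^ (N * n) * t n
  set G := ∑' n, q ^ ((N + 1) * n) * t n
  have h1 : F - G = ∑' n, q ^ (N * n) * (t n * (1 - q ^ n)) := by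
    rw [← (hS N).tsum_sub (hS (N + 1))]
    refine tsum_congr fun n => ?_
    rw [add_mul, pow_add]; ring
  have hd : Summable fun n => q ^ (N * n) * (t n * (1 - q ^ n)) := by
    refine ((hS N).sub (hS (N + 1))).congr fun n => ?_
    rw [add_mul, pow_add]; ring
  have h2 : ∑' n, q ^ (N * n) * (t n * (1 - q ^ n)) = q ^ N * (x * F - b * G) := by
    rw [hd.tsum_eq_zero_add, ← tsum_mul_left, ← tsum_mul_left,
      ← ((hS N).mul_left x).tsum_sub ((hS (N + 1)).mul_left b), ← tsum_mul_left]
    simp only [pow_zero, sub_self, mul_zero, zero_add]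
    refine tsum_congr fun n => ?_
    rw [ht, qBinomTerm_succ x b hq, mul_add, pow_add, add_mul, pow_add]
    ring
  rw [h2] at h1
  linear_combination h1

/-- The `q`-binomial theorem. -/
theorem qPochInf_mul_tsum_qBinomTerm {x q : ℂ} (b : ℂ) (hx : ‖x‖ < 1) (hq : ‖q‖ < 1) :
    qPochInf x q * ∑' n, qBinomTerm x b q n = qPochInf b q := by
  have hs := summable_qBinomTerm b hx hq
  have key : ∀ N : ℕ, qPoch x q N * ∑' n, qBinomTerm x b q n =
      qPoch b q N * ∑' n, q ^ (N * n) * qBinomTerm x b q n := by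
    intro N
    induction N with
    | zero => simp [qPoch_zero]
    | succ N ih =>
      rw [qPoch_succ, qPoch_succ, mul_right_comm, ih, mul_assoc, mul_assoc,
        ← tsum_qBinomTerm_step b hx hq N]
      ring
  -- As `N → ∞` the weight `q^(N n)` kills every term except `n = 0`, which equals 1.
  have hlim : Tendsto (fun N : ℕ => ∑' n, q ^ (N * n) * qBinomTerm x b q n) atTop
      (𝓝 (∑' n, if n = 0 then 1 else 0)) := by
    refine tendsto_tsum_of_dominated_convergence hs.norm (fun n => ?_)
      (Eventually.of_forall fun N n => norm_pow_mul_le hq _ _)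
    rcases eq_or_ne n 0 with rfl | hn
    · simp [qBinomTerm, qPoch_zero]
    · have hn' : ‖q ^ n‖ < 1 := by
        rw [norm_pow]; exact pow_lt_one₀ (norm_nonneg _) hq hn
      have := (tendsto_pow_atTop_nhds_zero_of_norm_lt_one hn').mul_const (qBinomTerm x b q n)
      simpa [hn, ← pow_mul, mul_comm n] using this
  rw [tsum_ite_eq] at hlim
  have h1 := (tendsto_qPoch x hq).mul_const (∑' n, qBinomTerm x b q n)
  have h2 := (tendsto_qPoch b hq).mul hlim
  rw [mul_one] at h2
  exact tendsto_nhds_unique (h1.congr key) h2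

theorem qPochInf_zero (q : ℂ) : qPochInf 0 q = 1 := by simp [qPochInf]

theorem qBinomTerm_zero_right (x q : ℂ) (n : ℕ) : qBinomTerm x 0 q n = x ^ n / qPoch q q n := by
  simp [qBinomTerm]

/-- Euler's expansion of `1 / (x; q)_∞`. -/
theorem qPochInf_mul_tsum_pow_div {x q : ℂ} (hx : ‖x‖ < 1) (hq : ‖q‖ < 1) :
    qPochInf x q * ∑' n : ℕ, x ^ n / qPoch q q n = 1 := by
  simpa only [qBinomTerm_zero_right, qPochInf_zero] using qPochInf_mul_tsum_qBinomTerm 0 hx hq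

/-- Euler's expansion exhibits an explicit inverse, so no separate argument about infinite products
is needed. -/
theorem qPochInf_ne_zero {x q : ℂ} (hx : ‖x‖ < 1) (hq : ‖q‖ < 1) : qPochInf x q ≠ 0 :=
  left_ne_zero_of_mul (qPochInf_mul_tsum_pow_div hx hq ▸ one_ne_zero)

theorem exists_norm_inv_qPoch_le {a q : ℂ} (ha : ‖a‖ < 1) (hq : ‖q‖ < 1) :
    ∃ C, ∀ n, ‖(qPoch a q n)⁻¹‖ ≤ C := by
  obtain ⟨C, hC⟩ := (Metric.isBounded_range_of_tendsto _
    ((tendsto_qPoch a hq).inv₀ (qPochInf_ne_zero ha hq))).exists_norm_le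
  exact ⟨C, fun n => hC _ ⟨n, rfl⟩⟩

theorem summable_prod_sub {x q : ℂ} (b : ℂ) (hx : ‖x‖ < 1) (hq : ‖q‖ < 1) :
    Summable fun n : ℕ => ∏ i ∈ range n, (x - b * q ^ i) := by
  obtain ⟨C, hC⟩ := exists_norm_qPoch_le q hq
  refine .of_norm_bounded ((summable_qBinomTerm b hx hq).norm.mul_left C) fun n => ?_
  have : ∏ i ∈ range n, (x - b * q ^ i) = qPoch q q n * qBinomTerm x b q n := by
    rw [qBinomTerm, mul_div_cancel₀ _ (qPoch_ne_zero hq hq n)]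
  rw [this, norm_mul]
  exact mul_le_mul_of_nonneg_right (hC n) (norm_nonneg _)

/-! ### Heine's transformation by double summation -/

theorem summable_heine {x b q : ℂ} (hx : ‖x‖ < 1) (hq : ‖q‖ < 1) :
    Summable fun p : ℕ × ℕ => q ^ (p.1 * (p.2 + 1)) / qPoch q q p.1 * qBinomTerm x b q p.2 := by
  have hs := summable_qBinomTerm b hx hq
  obtain ⟨C, hC⟩ := exists_norm_inv_qPoch_le hq hq
  have h1 := (summable_geometric_of_lt_one (norm_nonneg q) hq).mul_left C
  have hC0 : 0 ≤ C := (norm_nonneg _).trans (hC 0)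
  refine .of_norm_bounded (h1.mul_of_nonneg hs.norm
    (fun n => mul_nonneg hC0 (pow_nonneg (norm_nonneg q) n)) fun n => norm_nonneg _) ?_
  rintro ⟨M, n⟩
  rw [norm_mul, div_eq_mul_inv, norm_mul, mul_comm ‖q ^ _‖, norm_pow]
  refine mul_le_mul_of_nonneg_right (mul_le_mul (hC M) ?_ (by positivity) hC0) (norm_nonneg _)
  exact pow_le_pow_of_le_one (norm_nonneg _) hq.le (by nlinarith)

/-- For fixed `M` the factor `q^(M n)` is absorbed by scaling `x` and `b` to `x q^M` and `b q^M`,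
and the `q`-binomial theorem sums the row. -/
theorem heine_row {x b q : ℂ} (hx : ‖x‖ < 1) (hb : ‖b‖ < 1) (hq : ‖q‖ < 1) (M : ℕ) :
    qPochInf x q * ∑' n, q ^ (M * (n + 1)) / qPoch q q M * qBinomTerm x b q n =
      qPochInf b q * (q ^ M * qPoch x q M / (qPoch q q M * qPoch b q M)) := by
  have h1 := qPochInf_mul_tsum_qBinomTerm (b * q ^ M) (norm_mul_pow_lt_one hx hq M) hq
  have h2 : ∀ n, qBinomTerm (x * q ^ M) (b * q ^ M) q n = q ^ (M * n) * qBinomTerm x b q n := by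
    intro n
    rw [qBinomTerm, qBinomTerm, ← mul_div_assoc]
    congr 1
    have : q ^ (M * n) = ∏ i ∈ range n, q ^ M := by rw [prod_const, card_range, pow_mul]
    rw [this, ← prod_mul_distrib]
    exact prod_congr rfl fun i _ => by ring
  simp only [h2] at h1
  have h3 : ∑' n, q ^ (M * (n + 1)) / qPoch q q M * qBinomTerm x b q n =
      q ^ M / qPoch q q M * ∑' n, q ^ (M * n) * qBinomTerm x b q n := by
    rw [← tsum_mul_left]
    refine tsum_congr fun n => ?_
    rw [mul_add, pow_add]; ring
  rw [h3, qPochInf_eq_mul x hq M, qPochInf_eq_mul b hq M, ← h1]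
  have := qPoch_ne_zero hb hq M
  have := qPoch_ne_zero hq hq M
  field_simp

/-- For fixed `n` the series in `M` is Euler's expansion at `q^(n+1)`; the resulting product cancels
the denominator `(q;q)_n`. -/
theorem heine_col (x b : ℂ) {q : ℂ} (hq : ‖q‖ < 1) (n : ℕ) :
    qPochInf q q * ∑' M, q ^ (M * (n + 1)) / qPoch q q M * qBinomTerm x b q n =
      ∏ i ∈ range n, (x - b * q ^ i) := by
  have h1 := qPochInf_mul_tsum_pow_div (norm_mul_pow_lt_one hq hq n) hq
  have h2 : ∀ M : ℕ, (q * q ^ n) ^ M = q ^ (M * (n + 1)) := by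
    intro M; rw [← pow_succ', ← pow_mul, mul_comm]
  simp only [h2] at h1
  rw [tsum_mul_right, qPochInf_eq_mul q hq n, qBinomTerm]
  generalize ∏ i ∈ range n, (x - b * q ^ i) = Y
  calc _ = (qPoch q q n * (Y / qPoch q q n)) *
        (qPochInf (q * q ^ n) q * ∑' M, q ^ (M * (n + 1)) / qPoch q q M) := by ring
    _ = Y := by rw [h1, mul_one, mul_div_cancel₀ _ (qPoch_ne_zero hq hq n)]

/-- A special case of Heine's transformation. -/
theorem heine_transformation {x b q : ℂ} (hx : ‖x‖ < 1) (hb : ‖b‖ < 1) (hq : ‖q‖ < 1) :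
    qPochInf q q * qPochInf b q *
        ∑' M : ℕ, q ^ M * qPoch x q M / (qPoch q q M * qPoch b q M) =
      qPochInf x q * ∑' n : ℕ, ∏ i ∈ range n, (x - b * q ^ i) := by
  have hrow : ∑' M, qPochInf b q * (q ^ M * qPoch x q M / (qPoch q q M * qPoch b q M)) =
      ∑' M, qPochInf x q * ∑' n, q ^ (M * (n + 1)) / qPoch q q M * qBinomTerm x b q n :=
    tsum_congr fun M => (heine_row hx hb hq M).symm
  have hcol : ∑' n : ℕ, ∏ i ∈ range n, (x - b * q ^ i) =
      ∑' n, qPochInf q q * ∑' M, q ^ (M * (n + 1)) / qPoch q q M * qBinomTerm x b q n :=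
    tsum_congr fun n => (heine_col x b hq n).symm
  have hcomm : ∑' (n : ℕ) (M : ℕ), q ^ (M * (n + 1)) / qPoch q q M * qBinomTerm x b q n =
      ∑' (M : ℕ) (n : ℕ), q ^ (M * (n + 1)) / qPoch q q M * qBinomTerm x b q n :=
    Summable.tsum_comm (f := fun M n => q ^ (M * (n + 1)) / qPoch q q M * qBinomTerm x b q n)
      (summable_heine hx hq)
  rw [tsum_mul_left, tsum_mul_left] at hrow
  rw [tsum_mul_left] at hcol
  rw [hcol, mul_assoc, hrow, hcomm]
  ring

/-! ### A Rogers–Fine identity -/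

theorem choose_two_succ (n : ℕ) : (n + 1).choose 2 = n.choose 2 + n := by
  rw [Nat.choose_succ_succ' n 1, Nat.choose_one_right, add_comm]

theorem prod_sub_sq_mul (y q : ℂ) (n : ℕ) :
    ∏ i ∈ range n, (y - y ^ 2 * q ^ i) = y ^ n * qPoch y q n := by
  have : y ^ n = ∏ i ∈ range n, y := by rw [prod_const, card_range]
  rw [this, qPoch, ← prod_mul_distrib]
  exact prod_congr rfl fun i _ => by ring

theorem summable_pow_mul_qPoch {y q : ℂ} (hy : ‖y‖ < 1) (hq : ‖q‖ < 1) :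
    Summable fun n => y ^ n * qPoch y q n := 
  (summable_prod_sub (y ^ 2) hy hq).congr fun n => prod_sub_sq_mul y q n

/-- The intermediate series `T = ∑ y^n (yq;q)_n` links the two sides: peeling the first factor of
`(y;q)_{n+1}` relates the left side to `T`, and peeling the last factor of `(yq;q)_{n+1}` relates
`T` to the series at `yq`. -/
theorem tsum_pow_mul_qPoch_eq {y q : ℂ} (hy : ‖y‖ < 1) (hq : ‖q‖ < 1) :
    ∑' n, y ^ n * qPoch y q n =
      1 + y - q * y ^ 3 * ∑' n, (y * q) ^ n * qPoch (y * q) q n := by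
  have hyq : ‖y * q‖ < 1 := by simpa using norm_mul_pow_lt_one hy hq 1
  have hs := summable_pow_mul_qPoch hy hq
  have hs' := summable_pow_mul_qPoch hyq hq
  obtain ⟨C, hC⟩ := exists_norm_qPoch_le (y * q) hq
  have hT : Summable fun n => y ^ n * qPoch (y * q) q n := by
    refine .of_norm_bounded ((summable_geometric_of_lt_one (norm_nonneg y) hy).mul_left C)
      fun n => ?_
    rw [norm_mul, norm_pow, mul_comm]
    exact mul_le_mul_of_nonneg_right (hC n) (by positivity)
  have h1 : ∑' n, y ^ n * qPoch y q n = 1 + y * (1 - y) * ∑' n, y ^ n * qPoch (y * q) q n := by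
    rw [hs.tsum_eq_zero_add, ← tsum_mul_left]
    simp only [pow_zero, qPoch_zero, one_mul]
    congr 1
    refine tsum_congr fun n => ?_
    rw [qPoch_succ', pow_succ]; ring
  have h2 : ∑' n, y ^ n * qPoch (y * q) q n =
      1 + (y * ∑' n, y ^ n * qPoch (y * q) q n -
        y ^ 2 * q * ∑' n, (y * q) ^ n * qPoch (y * q) q n) := by
    rw [← tsum_mul_left, ← tsum_mul_left,
      ← (hT.mul_left y).tsum_sub (hs'.mul_left (y ^ 2 * q)), hT.tsum_eq_zero_add]
    simp only [pow_zero, qPoch_zero, one_mul]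
    congr 1
    refine tsum_congr fun n => ?_
    rw [qPoch_succ, pow_succ, mul_pow]; ring
  rw [h1]
  linear_combination y * h2

/-- Uniformity in `N` is what makes the remainder vanish when the functional equation is iterated.
It follows from `(y q^N;q)_n = (y;q)_{N+n} / (y;q)_N`. -/
theorem norm_tsum_pow_mul_qPoch_le {y q : ℂ} (hy : ‖y‖ < 1) (hq : ‖q‖ < 1) :
    ∃ B, ∀ N : ℕ, ‖∑' n, (y * q ^ N) ^ n * qPoch (y * q ^ N) q n‖ ≤ B := by
  obtain ⟨C, hC⟩ := exists_norm_qPoch_le y hq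
  obtain ⟨D, hD⟩ := exists_norm_inv_qPoch_le hy hq
  have hg := (summable_geometric_of_lt_one (norm_nonneg y) hy).mul_left (D * C)
  refine ⟨_, fun N => tsum_of_norm_bounded hg.hasSum fun n => ?_⟩
  have h : qPoch (y * q ^ N) q n = (qPoch y q N)⁻¹ * qPoch y q (N + n) := by
    rw [qPoch_add, inv_mul_cancel_left₀ (qPoch_ne_zero hy hq N)]
  rw [h, norm_mul, norm_mul, mul_comm, norm_pow]
  have hD0 : 0 ≤ D := (norm_nonneg _).trans (hD 0)
  have hC0 : 0 ≤ C := (norm_nonneg _).trans (hC 0)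
  have : ‖y * q ^ N‖ ≤ ‖y‖ := by rw [mul_comm]; exact norm_pow_mul_le hq N y
  gcongr
  · exact hD N
  · exact hC _

/-- A special case of the Rogers–Fine identity. -/
theorem tsum_pow_mul_qPoch_eq_tsum {y q : ℂ} (hy : ‖y‖ < 1) (hq : ‖q‖ < 1) :
    ∑' n, y ^ n * qPoch y q n =
      ∑' n : ℕ, (-1) ^ n * q ^ (3 * n.choose 2 + n) * y ^ (3 * n) * (1 + y * q ^ n) := by
  set f : ℕ → ℂ := fun n =>
    (-1) ^ n * q ^ (3 * n.choose 2 + n) * y ^ (3 * n) * (1 + y * q ^ n) with hf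
  set R : ℂ → ℂ := fun z => ∑' n, z ^ n * qPoch z q n with hR
  have hy3 : ‖y ^ 3‖ < 1 := by rw [norm_pow]; exact pow_lt_one₀ (norm_nonneg _) hy (by norm_num)
  have hle : ∀ n z, ‖(-1) ^ n * q ^ (3 * n.choose 2 + n) * y ^ (3 * n) * z‖ ≤ ‖y ^ 3‖ ^ n * ‖z‖ := by
    intro n z
    rw [norm_mul, norm_mul, norm_mul, pow_mul]
    simp only [norm_pow, norm_neg, norm_one, one_pow, one_mul]
    refine mul_le_mul_of_nonneg_right ?_ (norm_nonneg _)
    exact mul_le_of_le_one_left (by positivity) (pow_le_one₀ (norm_nonneg _) hq.le)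
  have hfs : Summable f := by
    refine .of_norm_bounded ((summable_geometric_of_lt_one (norm_nonneg _) hy3).mul_right 2)
      fun n => (hle n _).trans ?_
    refine mul_le_mul_of_nonneg_left ?_ (by positivity)
    calc ‖1 + y * q ^ n‖ ≤ ‖(1 : ℂ)‖ + ‖y * q ^ n‖ := norm_add_le _ _
      _ ≤ 1 + 1 := by
        rw [norm_one]; gcongr; exact (norm_mul_pow_lt_one hy hq n).le
      _ = 2 := by norm_num
  have key : ∀ N, ∑ n ∈ range N, f n = R y -
      (-1) ^ N * q ^ (3 * N.choose 2 + N) * y ^ (3 * N) * R (y * q ^ N) := by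
    intro N
    induction N with
    | zero => simp
    | succ N ih =>
      have h := tsum_pow_mul_qPoch_eq (norm_mul_pow_lt_one hy hq N) hq
      rw [mul_assoc y, ← pow_succ] at h
      rw [sum_range_succ, ih, choose_two_succ, hf]
      simp only [hR]
      rw [h]
      ring
  obtain ⟨B, hB⟩ := norm_tsum_pow_mul_qPoch_le hy hq
  have h0 : Tendsto (fun N : ℕ => (-1) ^ N * q ^ (3 * N.choose 2 + N) * y ^ (3 * N) * R (y * q ^ N))
      atTop (𝓝 0) := by
    have hb := (tendsto_pow_atTop_nhds_zero_of_lt_one (norm_nonneg _) hy3).mul_const B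
    rw [zero_mul] at hb
    refine squeeze_zero_norm (fun N => (hle N _).trans ?_) hb
    exact mul_le_mul_of_nonneg_left (hB N) (by positivity)
  have h1 := hfs.hasSum.tendsto_sum_nat
  simp only [key] at h1
  have h2 := (tendsto_const_nhds (x := R y)).sub h0
  rw [sub_zero] at h2
  exact tendsto_nhds_unique h2 h1

/-! ### The Bailey transform -/

/-- The Bailey transform for the conjugate Bailey pairs `δ_N = w_N q^N` relative to `q`. -/
theorem bailey_transform {q : ℂ} (hq : ‖q‖ < 1) {a w : ℕ → ℂ} {A W : ℝ}
    (ha : ∀ n, ‖a n‖ ≤ A) (hw : ∀ n, ‖w n‖ ≤ W) :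
    HasSum (fun k => a k * q ^ k *
        ∑' M, q ^ M * w (M + k) / (qPoch q q M * qPoch q q (M + (2 * k + 1))))
      (∑' N, q ^ N * w N *
        ∑ k ∈ range (N + 1), a k / (qPoch q q (N - k) * qPoch q q (N + k + 1))) := by
  obtain ⟨C, hC⟩ := exists_norm_inv_qPoch_le hq hq
  have hC0 : 0 ≤ C := (norm_nonneg _).trans (hC 0)
  have hA0 : 0 ≤ A := (norm_nonneg _).trans (ha 0)
  have hW0 : 0 ≤ W := (norm_nonneg _).trans (hw 0)
  set u : ℕ × ℕ → ℂ := fun p => a p.1 * q ^ p.1 *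
    (q ^ p.2 * w (p.2 + p.1) / (qPoch q q p.2 * qPoch q q (p.2 + (2 * p.1 + 1)))) with hu
  have hs : Summable u := by
    have hg := summable_geometric_of_lt_one (norm_nonneg q) hq
    have := (hg.mul_of_nonneg hg (fun n => by positivity) (fun n => by positivity)).mul_left
      (A * W * (C * C))
    refine .of_norm_bounded this ?_
    rintro ⟨k, M⟩
    simp only [hu]
    rw [div_eq_mul_inv, mul_inv]
    simp only [norm_mul, norm_pow]
    calc _ ≤ A * ‖q‖ ^ k * (‖q‖ ^ M * W * (C * C)) := by
          gcongr
          · exact ha k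
          · exact hw _
          · exact hC _
          · exact hC _
      _ = _ := by ring
  have h1 : HasSum (fun k => a k * q ^ k *
      ∑' M, q ^ M * w (M + k) / (qPoch q q M * qPoch q q (M + (2 * k + 1)))) (∑' p, u p) := by
    refine hs.hasSum.prod_fiberwise fun k => ?_
    rw [← tsum_mul_left]
    exact (hs.prod_factor k).hasSum
  convert h1 using 1
  -- The same double series is regrouped along the antidiagonals `k + M = N`.
  have hsig : Summable fun c : Σ n : ℕ, antidiagonal n =>
      u (Finset.HasAntidiagonal.sigmaAntidiagonalEquivProd c) :=
    Finset.HasAntidiagonal.sigmaAntidiagonalEquivProd.summable_iff.mpr hs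
  rw [← Finset.HasAntidiagonal.sigmaAntidiagonalEquivProd.tsum_eq u, hsig.tsum_sigma']
  · refine tsum_congr fun N => ?_
    rw [tsum_fintype, Finset.univ_eq_attach, mul_sum]
    refine Eq.trans ?_ (Finset.sum_attach (antidiagonal N) u).symm
    rw [Finset.Nat.sum_antidiagonal_eq_sum_range_succ (fun i j => u (i, j))]
    refine sum_congr rfl fun k hk => ?_
    have hk' : k ≤ N := by simpa [Nat.lt_succ_iff] using hk
    obtain ⟨d, rfl⟩ := Nat.exists_eq_add_of_le hk'
    simp only [hu, Nat.add_sub_cancel_left]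
    rw [show d + (2 * k + 1) = k + d + k + 1 by ring, add_comm d k, pow_add]
    ring
  · exact fun N => (hasSum_fintype _).summable

/-! ### Two Bailey pairs relative to `q` -/

/-- After multiplication by `1 - q^N` the sum telescopes. Keeping `1 - q^(N-K)` in the numerator
makes the right side visibly zero at `K = N` and avoids a factorial of index `N - K - 1`. -/
theorem sum_unit_bailey_pair_partial {q : ℂ} (hq : ‖q‖ < 1) (N K : ℕ) (hK : K ≤ N) :
    (1 - q ^ N) * ∑ k ∈ range (K + 1), (-1) ^ k * q ^ k.choose 2 * (1 - q ^ (2 * k + 1)) /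
        (qPoch q q (N - k) * qPoch q q (N + k + 1)) =
      (-1) ^ K * q ^ (K + 1).choose 2 * (1 - q ^ (K + 1)) * (1 - q ^ (N - K)) /
        (qPoch q q (N - K) * qPoch q q (N + K + 1)) := by
  induction K with
  | zero => simp; ring
  | succ K ih =>
    obtain ⟨d, rfl⟩ := Nat.exists_eq_add_of_le hK
    rw [sum_range_succ, mul_add, ih (by omega)]
    rw [show K + 1 + d - K = d + 1 by omega, show K + 1 + d - (K + 1) = d by omega,
      show K + 1 + d + (K + 1) + 1 = K + 1 + d + K + 1 + 1 by omega,
      qPoch_succ q q (K + 1 + d + K + 1), qPoch_succ q q d, choose_two_succ (K + 1)]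
    have h1 := qPoch_ne_zero hq hq d
    have h2 := qPoch_ne_zero hq hq (K + 1 + d + K + 1)
    have h3 : 1 - q * q ^ d ≠ 0 := one_sub_ne_zero_of_norm_lt (norm_mul_pow_lt_one hq hq d)
    have h4 : 1 - q * q ^ (K + 1 + d + K + 1) ≠ 0 :=
      one_sub_ne_zero_of_norm_lt (norm_mul_pow_lt_one hq hq _)
    generalize qPoch q q d = X at *
    generalize qPoch q q (K + 1 + d + K + 1) = Y at *
    rw [mul_div_assoc', div_add_div _ _ (by positivity) (by positivity), div_eq_div_iff (by positivity) (by positivity)]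
    ring

theorem sum_unit_bailey_pair {q : ℂ} (hq : ‖q‖ < 1) (N : ℕ) :
    ∑ k ∈ range (N + 1), (-1) ^ k * q ^ k.choose 2 * (1 - q ^ (2 * k + 1)) /
        (qPoch q q (N - k) * qPoch q q (N + k + 1)) = if N = 0 then 1 else 0 := by
  rcases eq_or_ne N 0 with rfl | hN
  · have : 1 - q ≠ 0 := one_sub_ne_zero_of_norm_lt hq
    simp [qPoch_zero, qPoch_succ, this]
  · have h := sum_unit_bailey_pair_partial hq N N le_rfl
    have h1 : 1 - q ^ N ≠ 0 :=
      one_sub_ne_zero_of_norm_lt (by rw [norm_pow]; exact pow_lt_one₀ (norm_nonneg _) hq hN)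
    simpa [hN, h1] using h

/-- The summand of the Bailey pair with `β_N = 1 / (q²; q²)_N`. -/
noncomputable def gaussTerm (q : ℂ) (N k : ℕ) : ℂ :=
  (-1) ^ k * q ^ k ^ 2 * (1 - q ^ (2 * k + 1)) / (qPoch q q (N - k) * qPoch q q (N + k + 1))

/-- The weight equals `(1 - q^(2N)) - (1 - q^(N-k))(1 - q^(N+k+1))`. It therefore measures the
failure of the recurrence in `N` termwise, and this failure telescopes in `k`. -/
theorem sum_gaussTerm_partial {q : ℂ} (hq : ‖q‖ < 1) (N K : ℕ) (hK : K ≤ N) :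
    ∑ k ∈ range (K + 1), gaussTerm q N k * (q ^ (N - k) + q ^ (N + k + 1) - q ^ (2 * N) * (1 + q)) =
      q ^ N * ((-1) ^ K * q ^ (K ^ 2 + K) * (1 - q ^ (2 * K + 2)) * (1 - q ^ (N - K)) /
        (qPoch q q (N - K) * qPoch q q (N + K + 1))) := by
  induction K with
  | zero => simp [gaussTerm]; ring
  | succ K ih =>
    obtain ⟨d, rfl⟩ := Nat.exists_eq_add_of_le hK
    rw [sum_range_succ, ih (by omega), gaussTerm]
    rw [show K + 1 + d - K = d + 1 by omega, show K + 1 + d - (K + 1) = d by omega,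
      show K + 1 + d + (K + 1) + 1 = K + 1 + d + K + 1 + 1 by omega,
      qPoch_succ q q (K + 1 + d + K + 1), qPoch_succ q q d]
    have h1 := qPoch_ne_zero hq hq d
    have h2 := qPoch_ne_zero hq hq (K + 1 + d + K + 1)
    have h3 : 1 - q * q ^ d ≠ 0 := one_sub_ne_zero_of_norm_lt (norm_mul_pow_lt_one hq hq d)
    have h4 : 1 - q * q ^ (K + 1 + d + K + 1) ≠ 0 :=
      one_sub_ne_zero_of_norm_lt (norm_mul_pow_lt_one hq hq _)
    generalize qPoch q q d = X at *
    generalize qPoch q q (K + 1 + d + K + 1) = Y at *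
    rw [mul_div_assoc', div_mul_eq_mul_div, mul_div_assoc', div_add_div _ _ (by positivity) (by positivity), div_eq_div_iff (by positivity) (by positivity)]
    ring

theorem sum_gaussTerm {q : ℂ} (hq : ‖q‖ < 1) (N : ℕ) :
    ∑ k ∈ range (N + 1), gaussTerm q N k = 1 / qPoch (q ^ 2) (q ^ 2) N := by
  have hq2 : ‖q ^ 2‖ < 1 := by rw [norm_pow]; exact pow_lt_one₀ (norm_nonneg _) hq (by norm_num)
  induction N with
  | zero =>
    have : 1 - q ≠ 0 := one_sub_ne_zero_of_norm_lt hq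
    simp [gaussTerm, qPoch_zero, qPoch_succ, this]
  | succ N ih =>
    have h1 := sum_gaussTerm_partial hq (N + 1) (N + 1) le_rfl
    have h2 : ∀ k ∈ range (N + 1), gaussTerm q N k =
        gaussTerm q (N + 1) k * ((1 - q ^ (N + 1 - k)) * (1 - q ^ (N + 1 + k + 1))) := by
      intro k hk
      have hk' : k ≤ N := by simpa [Nat.lt_succ_iff] using hk
      obtain ⟨d, rfl⟩ := Nat.exists_eq_add_of_le hk'
      rw [gaussTerm, gaussTerm, show k + d + 1 - k = d + 1 by omega, show k + d - k = d by omega,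
        show k + d + 1 + k + 1 = k + d + k + 1 + 1 by omega, qPoch_succ q q d,
        qPoch_succ q q (k + d + k + 1)]
      have h1 := qPoch_ne_zero hq hq d
      have h2 := qPoch_ne_zero hq hq (k + d + k + 1)
      have h3 : 1 - q * q ^ d ≠ 0 := one_sub_ne_zero_of_norm_lt (norm_mul_pow_lt_one hq hq d)
      have h4 : 1 - q * q ^ (k + d + k + 1) ≠ 0 :=
        one_sub_ne_zero_of_norm_lt (norm_mul_pow_lt_one hq hq _)
      generalize qPoch q q d = X at *
      generalize qPoch q q (k + d + k + 1) = Y at *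
      rw [div_mul_eq_mul_div, div_eq_div_iff (by positivity) (by positivity)]
      ring
    -- The added term `k = N + 1` vanishes through the factor `1 - q^0`.
    have h3 : ∑ k ∈ range (N + 1), gaussTerm q N k = ∑ k ∈ range (N + 1 + 1),
        gaussTerm q (N + 1) k * ((1 - q ^ (N + 1 - k)) * (1 - q ^ (N + 1 + k + 1))) := by
      rw [sum_range_succ _ (N + 1), sum_congr rfl h2]
      simp
    have h4 : (1 - q ^ (2 * (N + 1))) * ∑ k ∈ range (N + 1 + 1), gaussTerm q (N + 1) k =
        1 / qPoch (q ^ 2) (q ^ 2) N := by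
      rw [← ih, h3, ← sub_eq_zero, mul_sum, ← sum_sub_distrib]
      rw [Nat.sub_self, pow_zero, sub_self, mul_zero, zero_div, mul_zero] at h1
      rw [← h1]
      refine sum_congr rfl fun k hk => ?_
      have hk' : k ≤ N + 1 := by simpa [Nat.lt_succ_iff] using hk
      obtain ⟨d, hd⟩ := Nat.exists_eq_add_of_le hk'
      rw [hd, show k + d - k = d by omega]
      ring
    have h5 : 1 - q ^ 2 * (q ^ 2) ^ N ≠ 0 := one_sub_ne_zero_of_norm_lt (norm_mul_pow_lt_one hq2 hq2 N)
    rw [qPoch_succ, ← div_div, ← h4, eq_div_iff h5]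
    ring

/-! ### Conjugate Bailey pairs -/

theorem norm_sq_lt_one {q : ℂ} (hq : ‖q‖ < 1) : ‖q ^ 2‖ < 1 := by
  rw [norm_pow]; exact pow_lt_one₀ (norm_nonneg _) hq (by norm_num)

theorem qPochInf_neg_mul_qPochInf {q : ℂ} (hq : ‖q‖ < 1) :
    qPochInf (-q) q * qPochInf q q = qPochInf (q ^ 2) (q ^ 2) := by
  rw [qPochInf, qPochInf,
    ← (multipliable_qPochInf (-q) q hq).tprod_mul (multipliable_qPochInf q q hq), qPochInf]
  exact tprod_congr fun j => by ring

theorem qPochInf_sq_mul_qPochInf_sq {q : ℂ} (hq : ‖q‖ < 1) :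
    qPochInf q (q ^ 2) * qPochInf (q ^ 2) (q ^ 2) = qPochInf q q := by
  have h1 := multipliable_qPochInf q (q ^ 2) (norm_sq_lt_one hq)
  have h2 := multipliable_qPochInf (q ^ 2) (q ^ 2) (norm_sq_lt_one hq)
  have := tprod_even_mul_odd (f := fun j => 1 - q * q ^ j)
    (h1.congr fun j => by ring) (h2.congr fun j => by ring)
  rw [qPochInf, qPochInf, qPochInf, ← this]
  congr 1 <;> exact tprod_congr fun j => by ring

/-- This is Heine with `b = q^(2k+2)`: splitting off `(q;q)_{2k+1}` from both the denominator and
one copy of `(q;q)_∞` leaves exactly the shifted factorials. -/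
theorem heine_transformation_shift {x q : ℂ} (hx : ‖x‖ < 1) (hq : ‖q‖ < 1) (k : ℕ) :
    qPochInf q q ^ 2 *
        ∑' M, q ^ M * qPoch x q M / (qPoch q q M * qPoch q q (M + (2 * k + 1))) =
      qPochInf x q * ∑' n : ℕ, ∏ i ∈ range n, (x - q ^ (2 * k + 2) * q ^ i) := by
  have hb := norm_mul_pow_lt_one hq hq (2 * k + 1)
  have h0 := qPoch_ne_zero hq hq (2 * k + 1)
  rw [show q ^ (2 * k + 2) = q * q ^ (2 * k + 1) by ring, ← heine_transformation hx hb hq, sq,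
    mul_assoc, mul_assoc]
  congr 1
  have : ∀ M, q ^ M * qPoch x q M / (qPoch q q M * qPoch q q (M + (2 * k + 1))) =
      (qPoch q q (2 * k + 1))⁻¹ *
        (q ^ M * qPoch x q M / (qPoch q q M * qPoch (q * q ^ (2 * k + 1)) q M)) := by
    intro M
    rw [add_comm M, qPoch_add]
    rw [← one_div, div_mul_div_comm, one_mul]
    congr 1
    ring
  rw [tsum_congr this, tsum_mul_left, qPochInf_eq_mul q hq (2 * k + 1)]
  field_simp

theorem qPoch_zero_left (q : ℂ) (n : ℕ) : qPoch 0 q n = 1 := by simp [qPoch]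

theorem prod_neg_mul_pow (b q : ℂ) (n : ℕ) :
    ∏ i ∈ range n, (0 - b * q ^ i) = (-1) ^ n * q ^ n.choose 2 * b ^ n := by
  induction n with
  | zero => simp
  | succ n ih => rw [prod_range_succ, ih, choose_two_succ]; ring

theorem conjugate_pair_partial_theta {q : ℂ} (hq : ‖q‖ < 1) (k : ℕ) :
    qPochInf q q ^ 2 * ∑' M, q ^ M * 1 / (qPoch q q M * qPoch q q (M + (2 * k + 1))) =
      ∑' n : ℕ, (-1) ^ n * q ^ (n.choose 2 + (2 * k + 2) * n) := by
  -- The homogeneous products `∏ (x - b q^i)` make `x = 0` an ordinary case rather than a limit.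
  have h := heine_transformation_shift (x := 0) (by simp) hq k
  simp only [qPoch_zero_left, qPochInf_zero, one_mul] at h
  rw [h]
  refine tsum_congr fun n => ?_
  rw [prod_neg_mul_pow, ← pow_mul, pow_add, mul_assoc]

/-- With `x = -q^(k+1)` Heine's parameter `q^(2k+2)` is `x²`, precisely the situation where the
transformed series is of Rogers–Fine type. -/
theorem conjugate_pair_false_theta {q : ℂ} (hq : ‖q‖ < 1) (k : ℕ) :
    qPochInf q q ^ 2 *
        ∑' M, q ^ M * qPoch (-q) q (M + k) / (qPoch q q M * qPoch q q (M + (2 * k + 1))) =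
      qPochInf (-q) q *
        ∑' n : ℕ, q ^ (3 * n.choose 2 + n + 3 * (k + 1) * n) * (1 - q ^ (k + 1 + n)) := by
  have hq' : ‖-q‖ < 1 := by rwa [norm_neg]
  have hy := norm_mul_pow_lt_one hq' hq k
  have h := heine_transformation_shift hy hq k
  have h1 : ∀ M, q ^ M * qPoch (-q) q (M + k) / (qPoch q q M * qPoch q q (M + (2 * k + 1))) =
      qPoch (-q) q k * (q ^ M * qPoch (-q * q ^ k) q M /
        (qPoch q q M * qPoch q q (M + (2 * k + 1)))) := by
    intro M
    rw [add_comm M k, qPoch_add]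
    ring
  have h2 : ∑' n : ℕ, ∏ i ∈ range n, (-q * q ^ k - q ^ (2 * k + 2) * q ^ i) =
      ∑' n : ℕ, q ^ (3 * n.choose 2 + n + 3 * (k + 1) * n) * (1 - q ^ (k + 1 + n)) := by
    rw [show q ^ (2 * k + 2) = (-q * q ^ k) ^ 2 by ring,
      tsum_congr (fun n => prod_sub_sq_mul (-q * q ^ k) q n), tsum_pow_mul_qPoch_eq_tsum hy hq]
    refine tsum_congr fun n => ?_
    have h3 : (-q * q ^ k) ^ (3 * n) = (-1) ^ n * q ^ (3 * (k + 1) * n) := by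
      rw [neg_mul, neg_pow, ← pow_succ', ← pow_mul, pow_mul (-1 : ℂ) 3 n]
      norm_num
      ring
    have h4 : ((-1 : ℂ) ^ n) * (-1) ^ n = 1 := by rw [← mul_pow]; norm_num
    rw [h3, pow_add q (3 * n.choose 2 + n)]
    linear_combination q ^ (3 * n.choose 2 + n) * q ^ (3 * (k + 1) * n) *
      (1 - q ^ (k + 1 + n)) * h4
  rw [tsum_congr h1, tsum_mul_left, mul_left_comm, h, h2, qPochInf_eq_mul (-q) hq k, mul_assoc]

/-! ### The three basic double series -/

theorem norm_one_sub_pow_le {q : ℂ} (hq : ‖q‖ < 1) (n : ℕ) : ‖1 - q ^ n‖ ≤ 2 := by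
  calc ‖1 - q ^ n‖ ≤ ‖(1 : ℂ)‖ + ‖q ^ n‖ := norm_sub_le _ _
    _ ≤ 1 + 1 := by
      rw [norm_one, norm_pow]; gcongr; exact pow_le_one₀ (norm_nonneg _) hq.le
    _ = 2 := by norm_num

theorem norm_neg_one_pow_mul_pow_mul_le {q : ℂ} (hq : ‖q‖ < 1) (m : ℕ) {e d : ℕ} (h : d ≤ e) :
    ‖(-1) ^ m * q ^ e‖ ≤ ‖q‖ ^ d := by
  simp only [norm_mul, norm_pow, norm_neg, norm_one, one_pow, one_mul]
  exact pow_le_pow_of_le_one (norm_nonneg _) hq.le h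

theorem summable_of_norm_le_pow_add {q : ℂ} (hq : ‖q‖ < 1) {f : ℕ × ℕ → ℂ} (C : ℝ)
    (h : ∀ i j, ‖f (i, j)‖ ≤ ‖q‖ ^ (i + j) * C) : Summable f := by
  have hg := summable_geometric_of_lt_one (norm_nonneg q) hq
  refine .of_norm_bounded ((hg.mul_of_nonneg hg (fun n => by positivity)
    (fun n => by positivity)).mul_right C) fun p => ?_
  rw [← pow_add]
  exact h p.1 p.2

theorem HasSum.of_eq {ι : Type*} {f g : ι → ℂ} {s : ℂ} (h : HasSum f s) (e : ∀ i, g i = f i) :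
    HasSum g s := by rwa [funext e]

/-- The Bailey transform only yields iterated sums; upgrading to a sum over pairs permits exchanging
the indices and regrouping later. -/
theorem hasSum_prod_of_iterated {f : ℕ × ℕ → ℂ} {s : ℂ} (hf : Summable f)
    (h : HasSum (fun i => ∑' j, f (i, j)) s) : HasSum f s := by
  have := (hf.hasSum.prod_fiberwise fun i => (hf.prod_factor i).hasSum).unique h
  exact this ▸ hf.hasSum

theorem le_choose_two_succ (i : ℕ) : i ≤ (i + 1).choose 2 := by
  rw [choose_two_succ]; exact Nat.le_add_left _ _

/-- The terms of the double series for `(q; q)_∞²`. -/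
noncomputable def sqTerm (q : ℂ) (p : ℕ × ℕ) : ℂ :=
  (-1) ^ (p.1 + p.2) * q ^ ((p.1 + 1).choose 2 + p.2.choose 2 + (2 * p.1 + 2) * p.2) *
    (1 - q ^ (2 * p.1 + 1))

theorem norm_unit_bailey_le {q : ℂ} (hq : ‖q‖ < 1) (e : ℕ → ℕ) (k : ℕ) :
    ‖(-1) ^ k * q ^ e k * (1 - q ^ (2 * k + 1))‖ ≤ 2 := by
  rw [norm_mul]
  calc _ ≤ (1 : ℝ) * 2 := by
        gcongr
        · simpa using norm_neg_one_pow_mul_pow_mul_le hq k (Nat.zero_le (e k))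
        · exact norm_one_sub_pow_le hq _
    _ = 2 := one_mul _

theorem tsum_unit_bailey_pair {q : ℂ} (hq : ‖q‖ < 1) (w : ℕ → ℂ) (hw : w 0 = 1) :
    ∑' N, q ^ N * w N * ∑ k ∈ range (N + 1), (-1) ^ k * q ^ k.choose 2 * (1 - q ^ (2 * k + 1)) /
        (qPoch q q (N - k) * qPoch q q (N + k + 1)) = 1 := by
  simp only [sum_unit_bailey_pair hq, mul_ite, mul_one, mul_zero, tsum_ite_eq, pow_zero, hw]

theorem hasSum_sqTerm {q : ℂ} (hq : ‖q‖ < 1) : HasSum (sqTerm q) (qPochInf q q ^ 2) := by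
  refine hasSum_prod_of_iterated (summable_of_norm_le_pow_add hq 2 fun i j => ?_) ?_
  · rw [sqTerm, norm_mul]
    gcongr
    · refine norm_neg_one_pow_mul_pow_mul_le hq _ ?_
      have := le_choose_two_succ i
      dsimp only
      nlinarith [Nat.zero_le (i * j), Nat.zero_le (j.choose 2)]
    · exact norm_one_sub_pow_le hq _
  · have h := (bailey_transform hq (norm_unit_bailey_le hq fun k => k.choose 2) (w := fun _ => 1)
      (W := 1) (by simp)).mul_left (qPochInf q q ^ 2)
    rw [tsum_unit_bailey_pair hq _ rfl, mul_one] at h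
    refine h.of_eq fun k => ?_
    rw [mul_left_comm, conjugate_pair_partial_theta hq k, ← tsum_mul_left]
    refine tsum_congr fun n => ?_
    simp only [sqTerm, choose_two_succ k]
    ring

/-- The terms of the double series for `(q; q)_∞² (q; q²)_∞`. -/
noncomputable def cubicTerm (q : ℂ) (p : ℕ × ℕ) : ℂ :=
  (-1) ^ p.1 * q ^ ((p.1 + 1).choose 2 + (3 * p.2.choose 2 + p.2) + 3 * (p.1 + 1) * p.2) *
    ((1 - q ^ (2 * p.1 + 1)) * (1 - q ^ (p.1 + 1 + p.2)))

theorem qPochInf_neg_mul_eq_one {q : ℂ} (hq : ‖q‖ < 1) :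
    qPochInf (-q) q * qPochInf q (q ^ 2) = 1 := by
  have h1 := qPochInf_neg_mul_qPochInf hq
  have h2 := qPochInf_sq_mul_qPochInf_sq hq
  refine mul_right_cancel₀ (qPochInf_ne_zero hq hq) ?_
  linear_combination qPochInf q (q ^ 2) * h1 + h2

theorem hasSum_cubicTerm {q : ℂ} (hq : ‖q‖ < 1) :
    HasSum (cubicTerm q) (qPochInf q q ^ 2 * qPochInf q (q ^ 2)) := by
  refine hasSum_prod_of_iterated (summable_of_norm_le_pow_add hq (2 * 2) fun i j => ?_) ?_
  · rw [cubicTerm, norm_mul, norm_mul (1 - _)]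
    gcongr
    · refine norm_neg_one_pow_mul_pow_mul_le hq _ ?_
      have := le_choose_two_succ i
      dsimp only
      nlinarith [Nat.zero_le (i * j), Nat.zero_le (j.choose 2)]
    · exact norm_one_sub_pow_le hq _
    · exact norm_one_sub_pow_le hq _
  · obtain ⟨W, hW⟩ := exists_norm_qPoch_le (-q) hq
    have h := (bailey_transform hq (norm_unit_bailey_le hq fun k => k.choose 2) hW).mul_left
      (qPochInf q q ^ 2 * qPochInf q (q ^ 2))
    rw [tsum_unit_bailey_pair hq _ (qPoch_zero _ _), mul_one] at h
    refine h.of_eq fun k => ?_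
    have h1 := conjugate_pair_false_theta hq k
    have h2 := qPochInf_neg_mul_eq_one hq
    have h3 : ∑' n, cubicTerm q (k, n) = (-1) ^ k * q ^ k.choose 2 * (1 - q ^ (2 * k + 1)) * q ^ k *
        ∑' n : ℕ, q ^ (3 * n.choose 2 + n + 3 * (k + 1) * n) * (1 - q ^ (k + 1 + n)) := by
      rw [← tsum_mul_left]
      refine tsum_congr fun n => ?_
      simp only [cubicTerm, choose_two_succ k]
      ring
    rw [h3]
    linear_combination (-(qPochInf q (q ^ 2)) * ((-1) ^ k * q ^ k.choose 2 *
      (1 - q ^ (2 * k + 1)) * q ^ k)) * h1 - ((-1) ^ k * q ^ k.choose 2 *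
      (1 - q ^ (2 * k + 1)) * q ^ k) * (∑' n : ℕ, q ^ (3 * n.choose 2 + n + 3 * (k + 1) * n) *
        (1 - q ^ (k + 1 + n))) * h2

/-- The terms of the double series for `(q; q)_∞ (q²; q²)_∞`. -/
noncomputable def mixedTerm (q : ℂ) (p : ℕ × ℕ) : ℂ :=
  (-1) ^ (p.1 + p.2) * q ^ (p.1 ^ 2 + p.1 + p.2.choose 2 + (2 * p.1 + 2) * p.2) *
    (1 - q ^ (2 * p.1 + 1))

theorem hasSum_mixedTerm {q : ℂ} (hq : ‖q‖ < 1) :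
    HasSum (mixedTerm q) (qPochInf q q * qPochInf (q ^ 2) (q ^ 2)) := by
  refine hasSum_prod_of_iterated (summable_of_norm_le_pow_add hq 2 fun i j => ?_) ?_
  · rw [mixedTerm, norm_mul]
    gcongr
    · refine norm_neg_one_pow_mul_pow_mul_le hq _ ?_
      dsimp only
      nlinarith [Nat.zero_le (i * j), Nat.zero_le (j.choose 2), Nat.zero_le (i ^ 2)]
    · exact norm_one_sub_pow_le hq _
  · have h := (bailey_transform hq (norm_unit_bailey_le hq fun k => k ^ 2) (w := fun _ => 1)
      (W := 1) (by simp)).mul_left (qPochInf q q ^ 2)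
    have h1 : ∀ N : ℕ, q ^ N * 1 * ∑ k ∈ range (N + 1), (-1) ^ k * q ^ k ^ 2 *
        (1 - q ^ (2 * k + 1)) / (qPoch q q (N - k) * qPoch q q (N + k + 1)) =
        q ^ N / qPoch (q ^ 2) (q ^ 2) N := by
      intro N
      rw [mul_one, ← mul_one_div, ← sum_gaussTerm hq N]
      rfl
    rw [tsum_congr h1] at h
    have h2 := qPochInf_mul_tsum_pow_div hq (norm_sq_lt_one hq)
    -- Euler's expansion in base `q²` gives `∑ q^N/(q²;q²)_N = 1/(q;q²)_∞`.
    have h4 : qPochInf q q * qPochInf (q ^ 2) (q ^ 2) =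
        qPochInf q q ^ 2 * ∑' N : ℕ, q ^ N / qPoch (q ^ 2) (q ^ 2) N := by
      linear_combination (-(qPochInf q q * qPochInf (q ^ 2) (q ^ 2))) * h2 +
        (qPochInf q q * ∑' N : ℕ, q ^ N / qPoch (q ^ 2) (q ^ 2) N) * qPochInf_sq_mul_qPochInf_sq hq
    rw [h4]
    refine h.of_eq fun k => ?_
    · rw [mul_left_comm, conjugate_pair_partial_theta hq k, ← tsum_mul_left]
      refine tsum_congr fun n => ?_
      simp only [mixedTerm]
      ring

/-! ### Integer exponents and reindexing -/

theorem two_mul_choose_two (n : ℕ) : 2 * (n.choose 2 : ℤ) = n * (n - 1) := by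
  induction n with
  | zero => simp
  | succ n ih => rw [choose_two_succ]; push_cast; linarith

/-- Every integer exponent of `q` in the statement is shown to be a natural number through this
lemma, so `q = 0` needs no separate case. -/
theorem zpow_eq_pow_of_eq {z : ℤ} {n : ℕ} (q : ℂ) (h : z = n) : q ^ z = q ^ n := by
  rw [h, zpow_natCast]

theorem neg_one_zpow_eq_pow {z : ℤ} {n : ℕ} (w : ℤ) (h : z = n + 2 * w) :
    (-1 : ℂ) ^ z = (-1) ^ n := by
  rw [h, zpow_add₀ (by norm_num), zpow_mul, zpow_natCast]
  norm_num

theorem ediv_two_eq {a b : ℤ} (h : a = 2 * b) : a / 2 = b := by omega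

theorem summable_and_hasSum_of_hasSum {f : ℕ+ × ℕ → ℂ} {g : ℕ × ℕ → ℂ} {s : ℂ} (hg : HasSum g s)
    (e : ∀ i n, f (i.succPNat, n) = g (i, n)) :
    Summable f ∧ HasSum (fun k => ∑' n, f (k, n)) s := by
  have h : HasSum f s := by
    rw [← ((Equiv.pnatEquivNat.symm).prodCongr (Equiv.refl ℕ)).hasSum_iff]
    exact hg.of_eq fun p => e p.1 p.2
  exact ⟨h.summable, h.prod_fiberwise fun k => (h.summable.prod_factor k).hasSum⟩

theorem tsum_eq_tsum_zero_add {G : ℕ × ℕ → ℂ} (hG : Summable G) :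
    ∑' p, G p = ∑' n, G (n, 0) + ∑' p : ℕ × ℕ, G (p.1, p.2 + 1) := by
  have hinj : Function.Injective fun p : ℕ × ℕ => (p.1, p.2 + 1) := by
    rintro ⟨a, b⟩ ⟨c, d⟩ h
    simpa using h
  have hinj0 : Function.Injective fun n : ℕ => (n, 0) := fun a b h => by simpa using h
  have h1 : Summable fun p : ℕ × ℕ => G (p.1, p.2 + 1) := hG.comp_injective hinj
  have h0 : Summable fun n : ℕ => G (n, 0) := hG.comp_injective hinj0
  rw [hG.tsum_prod, h1.tsum_prod, ← h0.tsum_add h1.prod]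
  exact tsum_congr fun n => (hG.prod_factor n).tsum_eq_zero_add

/-- The index region of a Hecke-type sum is cut into two disjoint cones, each parametrized by `ℕ ×
ℕ`. -/
theorem hasSum_sum_of_cover {S : ℕ → Finset ℤ} {f : ℕ → ℤ → ℂ} {a b : ℂ}
    {φ ψ : ℕ × ℕ → ℕ × ℤ} (hφ : Function.Injective φ) (hψ : Function.Injective ψ)
    (hne : ∀ p p', φ p ≠ ψ p')
    (hcover : ∀ i n, n ∈ S i ↔ (∃ p, φ p = (i, n)) ∨ ∃ p, ψ p = (i, n))
    (ha : HasSum (fun p => f (φ p).1 (φ p).2) a) (hb : HasSum (fun p => f (ψ p).1 (ψ p).2) b) :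
    HasSum (fun i => ∑ n ∈ S i, f i n) (a + b) := by
  set F : ℕ × ℤ → ℂ := fun p => if p.2 ∈ S p.1 then f p.1 p.2 else 0 with hF
  have hFφ : ∀ p, F (φ p) = f (φ p).1 (φ p).2 := fun p =>
    if_pos ((hcover _ _).mpr (Or.inl ⟨p, rfl⟩))
  have hFψ : ∀ p, F (ψ p) = f (ψ p).1 (ψ p).2 := fun p =>
    if_pos ((hcover _ _).mpr (Or.inr ⟨p, rfl⟩))
  have hinj : Function.Injective (Sum.elim φ ψ) := hφ.sumElim hψ hne
  have h : HasSum F (a + b) := by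
    refine (hinj.hasSum_iff fun x hx => if_neg fun hm => hx ?_).mp
      (HasSum.sum (f := F ∘ Sum.elim φ ψ) (ha.of_eq hFφ) (hb.of_eq hFψ))
    rcases (hcover _ _).mp hm with ⟨p, hp⟩ | ⟨p, hp⟩
    · exact ⟨Sum.inl p, hp⟩
    · exact ⟨Sum.inr p, hp⟩
  refine h.prod_fiberwise fun i => ?_
  have h1 : HasSum (fun n => F (i, n)) (∑ n ∈ S i, F (i, n)) :=
    hasSum_sum_of_ne_finset_zero fun n hn => if_neg hn
  rwa [sum_congr rfl fun n hn => (if_pos hn : F (i, n) = f i n)] at h1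

theorem summable_signed_pow {q : ℂ} (hq : ‖q‖ < 1) (m e : ℕ × ℕ → ℕ)
    (h : ∀ i j, i + j ≤ e (i, j)) : Summable fun p => (-1) ^ m p * q ^ e p :=
  summable_of_norm_le_pow_add hq 1 fun i j => by
    rw [mul_one]; exact norm_neg_one_pow_mul_pow_mul_le hq _ (h i j)

/-! ### The Hecke-type sums -/

theorem hasSum_hecke_mixed {q : ℂ} (hq : ‖q‖ < 1) :
    HasSum
      (fun k : ℕ => ∑ n ∈ Finset.Icc (-((k : ℤ) / 2)) ((k : ℤ) / 2),
        (-1 : ℂ) ^ (n + (k : ℤ) : ℤ) * q ^ (((k : ℤ) ^ 2 + k) / 2 - n ^ 2 : ℤ))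
      (qPochInf q q * qPochInf (q ^ 2) (q ^ 2)) := by
  set M : ℕ × ℕ → ℂ := fun p =>
    (-1) ^ (p.1 + p.2) * q ^ (p.1 ^ 2 + p.1 + p.2.choose 2 + (2 * p.1 + 2) * p.2) with hM
  set B : ℕ × ℕ → ℂ := fun p =>
    (-1) ^ (p.1 + p.2) * q ^ (p.1 ^ 2 + p.1 + p.2.choose 2 + (2 * p.1 + 1) * p.2) with hB
  have hMs : Summable M := summable_signed_pow hq _ _ fun i j => by
    dsimp only
    nlinarith [Nat.zero_le (i * j), Nat.zero_le (j.choose 2), Nat.zero_le (i ^ 2)]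
  have hBs : Summable B := summable_signed_pow hq _ _ fun i j => by
    dsimp only
    nlinarith [Nat.zero_le (i * j), Nat.zero_le (j.choose 2), Nat.zero_le (i ^ 2)]
  have hM1 : Summable fun p : ℕ × ℕ => M (p.1, p.2 + 1) :=
    hMs.comp_injective (i := fun p : ℕ × ℕ => (p.1, p.2 + 1)) fun p p' h => by
      simpa [Prod.ext_iff] using h
  have hB1 : Summable fun p : ℕ × ℕ => B (p.1, p.2 + 1) :=
    hBs.comp_injective (i := fun p : ℕ × ℕ => (p.1, p.2 + 1)) fun p p' h => by
      simpa [Prod.ext_iff] using h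
  -- Expanding `1 - q^(2n+1)` gives `M` plus `B` shifted by one. As `M` and `B` agree on the column
  -- `j = 0`, that column passes from `M` to `B`.
  have hval : qPochInf q q * qPochInf (q ^ 2) (q ^ 2) =
      ∑' p, B p + ∑' p : ℕ × ℕ, M (p.1, p.2 + 1) := by
    have h0 : ∑' n, B (n, 0) = ∑' n, M (n, 0) := tsum_congr fun n => by simp [hM, hB]
    have h1 : ∀ p, mixedTerm q p = M p + B (p.1, p.2 + 1) := by
      rintro ⟨n, j⟩
      simp only [mixedTerm, hM, hB, choose_two_succ]
      ring
    rw [← (hasSum_mixedTerm hq).tsum_eq, tsum_congr h1, hMs.tsum_add hB1,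
      tsum_eq_tsum_zero_add hMs, tsum_eq_tsum_zero_add hBs, h0]
    ring
  rw [hval]
  -- The full series `B` fills `n ≥ 0`, and `M` without its first column fills `n < 0`.
  refine hasSum_sum_of_cover (φ := fun p => (2 * p.1 + p.2, (p.1 : ℤ)))
    (ψ := fun p => (2 * p.1 + 2 + p.2, -((p.1 : ℤ) + 1))) ?_ ?_ ?_ ?_ ?_ ?_
  · rintro ⟨a, b⟩ ⟨c, d⟩ h
    simp only [Prod.mk.injEq] at h ⊢
    omega
  · rintro ⟨a, b⟩ ⟨c, d⟩ h
    simp only [Prod.mk.injEq] at h ⊢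
    omega
  · rintro ⟨a, b⟩ ⟨c, d⟩ h
    simp only [Prod.mk.injEq] at h
    omega
  · intro i n
    simp only [mem_Icc, Prod.exists, Prod.mk.injEq]
    constructor
    · rintro ⟨h1, h2⟩
      rcases le_or_gt 0 n with hn | hn
      · exact Or.inl ⟨n.toNat, i - 2 * n.toNat, by omega, by omega⟩
      · exact Or.inr ⟨(-n - 1).toNat, i - 2 * (-n).toNat, by omega, by omega⟩
    · rintro (⟨a, b, h1, h2⟩ | ⟨a, b, h1, h2⟩) <;> omega
  · refine hBs.hasSum.of_eq ?_
    rintro ⟨n, j⟩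
    have hj := two_mul_choose_two j
    simp only [hB]
    rw [neg_one_zpow_eq_pow (n := n + j) n (by push_cast; ring),
      zpow_eq_pow_of_eq (n := n ^ 2 + n + j.choose 2 + (2 * n + 1) * j)]
    rw [ediv_two_eq (b := 2 * (n : ℤ) ^ 2 + n + j.choose 2 + (2 * n + 1) * j)]
    · push_cast; ring
    · push_cast; linarith
  · refine hM1.hasSum.of_eq ?_
    rintro ⟨n, j⟩
    have hj := two_mul_choose_two j
    simp only [hM, choose_two_succ]
    rw [neg_one_zpow_eq_pow (n := n + (j + 1)) 0 (by push_cast; ring),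
      zpow_eq_pow_of_eq (n := n ^ 2 + n + (j.choose 2 + j) + (2 * n + 2) * (j + 1))]
    rw [ediv_two_eq (b := (n : ℤ) ^ 2 + n + (j.choose 2 + j) + (2 * n + 2) * (j + 1) + (n + 1) ^ 2)]
    · push_cast; ring
    · push_cast; linarith

theorem hasSum_hecke_cubic {q : ℂ} (hq : ‖q‖ < 1) :
    HasSum
      (fun k : ℕ+ => ∑ n ∈ Finset.Icc (-(((k : ℤ) - 1) / 3)) ((k : ℤ) / 3),
        (-1 : ℂ) ^ (n + (k : ℤ) + 1 : ℤ) *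
          q ^ (((k : ℤ) ^ 2 - k) / 2 - 3 * n ^ 2 + n : ℤ) * (1 - q ^ (k : ℕ)))
      (qPochInf q q ^ 2 * qPochInf q (q ^ 2)) := by
  set A : ℕ × ℕ → ℂ := fun p => (-1) ^ p.1 *
    q ^ ((p.1 + 1).choose 2 + 3 * p.2.choose 2 + 4 * p.2 + 3 * p.1 * p.2) with hA
  set Y : ℕ × ℕ → ℂ := fun p => (-1) ^ p.1 *
    q ^ ((p.1 + 1).choose 2 + 3 * p.2.choose 2 + 2 * p.2 + 3 * p.1 * p.2) with hY
  set U : ℕ × ℕ → ℂ := fun p => (-1) ^ (p.1 + 1) *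
    q ^ ((p.1 + 1).choose 2 + 3 * p.2.choose 2 + 4 * p.2 + 3 * p.1 * p.2 + (2 * p.1 + 1)) with hU
  set V : ℕ × ℕ → ℂ := fun p => (-1) ^ (p.1 + 1) *
    q ^ ((p.1 + 1).choose 2 + 3 * p.2.choose 2 + 4 * p.2 + 3 * p.1 * p.2 + (p.1 + 1 + p.2)) with hV
  have hAs : Summable A := summable_signed_pow hq _ _ fun i j => by
    have := le_choose_two_succ i
    dsimp only
    nlinarith [Nat.zero_le (i * j)]
  have hYs : Summable Y := summable_signed_pow hq _ _ fun i j => by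
    have := le_choose_two_succ i
    dsimp only
    nlinarith [Nat.zero_le (i * j)]
  have hUs : Summable U := summable_signed_pow hq _ _ fun i j => by
    have := le_choose_two_succ i
    dsimp only
    nlinarith [Nat.zero_le (i * j)]
  have hVs : Summable V := summable_signed_pow hq _ _ fun i j => by
    have := le_choose_two_succ i
    dsimp only
    nlinarith [Nat.zero_le (i * j)]
  have hA1 : Summable fun p : ℕ × ℕ => A (p.1, p.2 + 1) :=
    hAs.comp_injective (i := fun p : ℕ × ℕ => (p.1, p.2 + 1)) fun p p' h => by
      simpa [Prod.ext_iff] using h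
  have hY1 : Summable fun p : ℕ × ℕ => Y (p.1, p.2 + 1) :=
    hYs.comp_injective (i := fun p : ℕ × ℕ => (p.1, p.2 + 1)) fun p p' h => by
      simpa [Prod.ext_iff] using h
  -- The product of two binomials expands into `A`, `U`, `V` and `Y` shifted by one; the common
  -- column `n = 0` of `A` and `Y` passes from `A` to `Y`.
  have hval : qPochInf q q ^ 2 * qPochInf q (q ^ 2) =
      (∑' p, U p + ∑' p : ℕ × ℕ, A (p.1, p.2 + 1)) + (∑' p, Y p + ∑' p, V p) := by
    have h0 : ∑' n, A (n, 0) = ∑' n, Y (n, 0) := tsum_congr fun n => by simp [hA, hY]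
    have h1 : ∀ p, cubicTerm q p = (A p + Y (p.1, p.2 + 1)) + (U p + V p) := by
      rintro ⟨i, n⟩
      simp only [cubicTerm, hA, hY, hU, hV, choose_two_succ]
      ring
    rw [← (hasSum_cubicTerm hq).tsum_eq, tsum_congr h1, (hAs.add hY1).tsum_add (hUs.add hVs),
      hAs.tsum_add hY1, hUs.tsum_add hVs,
      tsum_eq_tsum_zero_add hAs, tsum_eq_tsum_zero_add hYs, h0]
    ring
  rw [hval, ← Equiv.pnatEquivNat.symm.hasSum_iff]
  have hk : ∀ i : ℕ, ((Equiv.pnatEquivNat.symm i : ℕ+) : ℕ) = i + 1 := fun i => rfl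
  simp only [Function.comp_def, hk, Nat.cast_add, Nat.cast_one]
  -- The first coordinate is `k - 1`. On `n > 0` the factor `1 - q^k` combines `U` with shifted `A`;
  -- on `n ≤ 0` it combines `Y` with `V`.
  refine hasSum_sum_of_cover (φ := fun p => (3 * p.2 + 2 + p.1, (p.2 : ℤ) + 1))
    (ψ := fun p => (3 * p.2 + p.1, -(p.2 : ℤ))) ?_ ?_ ?_ ?_ ?_ ?_
  · rintro ⟨a, b⟩ ⟨c, d⟩ h
    simp only [Prod.mk.injEq] at h ⊢
    omega
  · rintro ⟨a, b⟩ ⟨c, d⟩ h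
    simp only [Prod.mk.injEq] at h ⊢
    omega
  · rintro ⟨a, b⟩ ⟨c, d⟩ h
    simp only [Prod.mk.injEq] at h
    omega
  · intro i n
    simp only [mem_Icc, Prod.exists, Prod.mk.injEq]
    constructor
    · rintro ⟨h1, h2⟩
      rcases le_or_gt n 0 with hn | hn
      · exact Or.inr ⟨i - 3 * (-n).toNat, (-n).toNat, by omega, by omega⟩
      · exact Or.inl ⟨i + 1 - 3 * n.toNat, (n - 1).toNat, by omega, by omega⟩
    · rintro (⟨a, b, h1, h2⟩ | ⟨a, b, h1, h2⟩) <;> omega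
  · refine (hUs.hasSum.add hA1.hasSum).of_eq ?_
    rintro ⟨j, m⟩
    have hj := two_mul_choose_two j
    have hm := two_mul_choose_two m
    simp only [hU, hA, choose_two_succ]
    rw [neg_one_zpow_eq_pow (n := j + 1) (2 * m + 2) (by push_cast; ring),
      zpow_eq_pow_of_eq
        (n := j.choose 2 + j + 3 * m.choose 2 + 4 * m + 3 * j * m + (2 * j + 1))]
    · ring
    rw [ediv_two_eq (b := (j.choose 2 : ℤ) + 3 * m.choose 2 + 3 * j + 3 * j * m + 1 + 4 * m - m - 1
      + 3 * (m + 1) ^ 2)]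
    · push_cast; ring
    · push_cast; linarith
  · refine (hYs.hasSum.add hVs.hasSum).of_eq ?_
    rintro ⟨j, m⟩
    have hj := two_mul_choose_two j
    have hm := two_mul_choose_two m
    simp only [hY, hV, choose_two_succ]
    rw [neg_one_zpow_eq_pow (n := j) (m + 1) (by push_cast; ring),
      zpow_eq_pow_of_eq
        (n := j.choose 2 + j + 3 * m.choose 2 + 2 * m + 3 * j * m)]
    · ring
    rw [ediv_two_eq (b := (j.choose 2 : ℤ) + j + 3 * m.choose 2 + 2 * m + 3 * j * m + m
      + 3 * m ^ 2)]
    · push_cast; ring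
    · push_cast; linarith

/-! ### The first form and the final assembly -/

theorem HasSum.prod_swap {f : ℕ × ℕ → ℂ} {s : ℂ} (h : HasSum f s) :
    HasSum (fun p : ℕ × ℕ => f (p.2, p.1)) s :=
  (Equiv.prodComm ℕ ℕ).hasSum_iff.mpr h

theorem summable_partial_theta {q : ℂ} (hq : ‖q‖ < 1) (i : ℕ) :
    Summable fun n : ℕ => (-1) ^ n * q ^ (n.choose 2 + (2 * i + 2) * n) :=
  .of_norm_bounded (summable_geometric_of_lt_one (norm_nonneg q) hq) fun n =>
    norm_neg_one_pow_mul_pow_mul_le hq _ (by nlinarith [Nat.zero_le (i * n)])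

theorem sq_first_form_term (q : ℂ) (i m : ℕ) :
    (-1 : ℂ) ^ ((m.succPNat : ℕ) + (i.succPNat : ℕ) + 1) *
      q ^ ((i.succPNat : ℤ) * (i.succPNat - 1) / 2 + (m.succPNat : ℤ) * (m.succPNat - 3) / 2 +
        2 * i.succPNat * m.succPNat : ℤ) * (1 + q ^ (m.succPNat : ℕ)) =
    (-1) ^ (i + m + 1) * q ^ ((i + 1).choose 2 + m.choose 2 + (2 * i + 2) * m + (2 * i + 1)) *
      (1 + q ^ (m + 1)) := by
  have hi := two_mul_choose_two i
  have hm := two_mul_choose_two m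
  simp only [Nat.succPNat_coe, Nat.succ_eq_add_one, choose_two_succ]
  rw [zpow_eq_pow_of_eq (n := i.choose 2 + i + m.choose 2 + (2 * i + 2) * m + (2 * i + 1))]
  · ring
  rw [ediv_two_eq (b := (i.choose 2 + i : ℤ)), ediv_two_eq (b := (m.choose 2 - 1 : ℤ))]
  · push_cast; ring
  · push_cast; linarith
  · push_cast; linarith

theorem sq_first_form {q : ℂ} (hq : ‖q‖ < 1) :
    (Summable fun p : ℕ+ × ℕ+ =>
        (-1 : ℂ) ^ ((p.2 : ℕ) + (p.1 : ℕ) + 1) *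
          q ^ ((p.1 : ℤ) * (p.1 - 1) / 2 + (p.2 : ℤ) * (p.2 - 3) / 2 + 2 * p.1 * p.2 : ℤ) *
          (1 + q ^ (p.2 : ℕ))) ∧
      HasSum
        (fun k : ℕ+ =>
          (-1 : ℂ) ^ ((k : ℕ) + 1) * q ^ ((k : ℤ) * (k - 1) / 2 : ℤ) +
            ∑' n : ℕ+,
              (-1 : ℂ) ^ ((n : ℕ) + (k : ℕ) + 1) *
                q ^ ((k : ℤ) * (k - 1) / 2 + (n : ℤ) * (n - 3) / 2 + 2 * k * n : ℤ) *
                (1 + q ^ (n : ℕ)))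
        (qPochInf q q ^ 2) := by
  constructor
  · rw [← ((Equiv.pnatEquivNat.symm).prodCongr Equiv.pnatEquivNat.symm).summable_iff]
    refine summable_of_norm_le_pow_add hq 2 fun i m => ?_
    refine (congrArg norm (sq_first_form_term q i m)).trans_le ?_
    rw [norm_mul]
    gcongr
    · refine norm_neg_one_pow_mul_pow_mul_le hq _ ?_
      nlinarith [Nat.zero_le (i * m)]
    · calc ‖1 + q ^ (m + 1)‖ ≤ ‖(1 : ℂ)‖ + ‖q ^ (m + 1)‖ := norm_add_le _ _
        _ ≤ 1 + 1 := by
          rw [norm_one, norm_pow]; gcongr; exact pow_le_one₀ (norm_nonneg _) hq.le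
        _ = 2 := by norm_num
  · have h := (hasSum_sqTerm hq).prod_fiberwise fun i =>
      ((hasSum_sqTerm hq).summable.prod_factor i).hasSum
    rw [← Equiv.pnatEquivNat.symm.hasSum_iff]
    refine h.of_eq fun i => ?_
    have hs := summable_partial_theta hq i
    have hs1 := (summable_nat_add_iff 1).mpr hs
    set S := ∑' n : ℕ, (-1) ^ n * q ^ (n.choose 2 + (2 * i + 2) * n) with hS
    have hS1 : S = 1 + ∑' n : ℕ, (-1) ^ (n + 1) *
        q ^ ((n + 1).choose 2 + (2 * i + 2) * (n + 1)) := by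
      rw [hS, hs.tsum_eq_zero_add]; simp
    have hR : ∑' n, sqTerm q (i, n) =
        (-1) ^ i * q ^ (i + 1).choose 2 * (1 - q ^ (2 * i + 1)) * S := by
      rw [← tsum_mul_left]
      exact tsum_congr fun n => by simp only [sqTerm]; ring
    -- Term `m + 1` of `S` is paired with term `m` of `q^(2i+1) S`, which produces the factor `1 +
    -- q^(m+1)`. The unpaired leading 1 of `S` is the isolated term of the identity.
    have hL : ∑' n : ℕ+, (-1 : ℂ) ^ ((n : ℕ) + (i.succPNat : ℕ) + 1) *
        q ^ ((i.succPNat : ℤ) * (i.succPNat - 1) / 2 + (n : ℤ) * (n - 3) / 2 +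
          2 * i.succPNat * n : ℤ) * (1 + q ^ (n : ℕ)) =
        (-1) ^ i * q ^ (i + 1).choose 2 * (S - 1 - q ^ (2 * i + 1) * S) := by
      rw [hS1, add_sub_cancel_left, ← hS1, hS, ← tsum_mul_left, ← hs1.tsum_sub (hs.mul_left _),
        ← tsum_mul_left, ← Equiv.pnatEquivNat.symm.tsum_eq]
      refine tsum_congr fun m => (sq_first_form_term q i m).trans ?_
      rw [choose_two_succ m]
      ring
    have h0 : q ^ ((i.succPNat : ℤ) * (i.succPNat - 1) / 2 : ℤ) = q ^ (i + 1).choose 2 := by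
      refine zpow_eq_pow_of_eq q (ediv_two_eq ?_)
      rw [two_mul_choose_two]
      simp
    rw [hR]
    refine (congrArg₂ (· + ·) (congrArg ((-1 : ℂ) ^ ((i.succPNat : ℕ) + 1) * ·) h0) hL).trans ?_
    simp only [Nat.succPNat_coe, Nat.succ_eq_add_one]
    ring

theorem corollary2p6 (q : ℂ) (hq : ‖q‖ < 1) :
    -- (q;q)_∞², first form
    ((Summable fun p : ℕ+ × ℕ+ =>
        (-1 : ℂ) ^ ((p.2 : ℕ) + (p.1 : ℕ) + 1) *
          q ^ ((p.1 : ℤ) * (p.1 - 1) / 2 + (p.2 : ℤ) * (p.2 - 3) / 2 + 2 * p.1 * p.2 : ℤ) *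
          (1 + q ^ (p.2 : ℕ))) ∧
      HasSum
        (fun k : ℕ+ =>
          (-1 : ℂ) ^ ((k : ℕ) + 1) * q ^ ((k : ℤ) * (k - 1) / 2 : ℤ) +
            ∑' n : ℕ+,
              (-1 : ℂ) ^ ((n : ℕ) + (k : ℕ) + 1) *
                q ^ ((k : ℤ) * (k - 1) / 2 + (n : ℤ) * (n - 3) / 2 + 2 * k * n : ℤ) *
                (1 + q ^ (n : ℕ)))
        (qPochInf q q ^ 2)) ∧
    -- (q;q)_∞², second form
    ((Summable fun p : ℕ+ × ℕ =>
        (-1 : ℂ) ^ (p.2 + (p.1 : ℕ) + 1) *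
          q ^ ((p.1 : ℤ) * (p.1 + 1) / 2 + (p.2 : ℤ) * (p.2 - 3) / 2 + 2 * p.1 * p.2 - 1 : ℤ) *
          (1 - q ^ (2 * p.2 + 1))) ∧
      HasSum
        (fun k : ℕ+ => ∑' n : ℕ,
          (-1 : ℂ) ^ (n + (k : ℕ) + 1) *
            q ^ ((k : ℤ) * (k + 1) / 2 + (n : ℤ) * (n - 3) / 2 + 2 * k * n - 1 : ℤ) *
            (1 - q ^ (2 * n + 1)))
        (qPochInf q q ^ 2)) ∧
    -- (q;q)_∞² (q;q²)_∞, double series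
    ((Summable fun p : ℕ+ × ℕ =>
        (-1 : ℂ) ^ ((p.1 : ℕ) + 1) *
          q ^ ((p.1 : ℤ) * (p.1 - 1) / 2 + (p.2 : ℤ) * (3 * p.2 - 1) / 2 + 3 * p.1 * p.2 : ℤ) *
          (1 - q ^ (2 * (p.1 : ℤ) - 1 : ℤ)) * (1 - q ^ ((p.1 : ℕ) + p.2))) ∧
      HasSum
        (fun k : ℕ+ => ∑' n : ℕ,
          (-1 : ℂ) ^ ((k : ℕ) + 1) *
            q ^ ((k : ℤ) * (k - 1) / 2 + (n : ℤ) * (3 * n - 1) / 2 + 3 * k * n : ℤ) *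
            (1 - q ^ (2 * (k : ℤ) - 1 : ℤ)) * (1 - q ^ ((k : ℕ) + n)))
        (qPochInf q q ^ 2 * qPochInf q (q ^ 2))) ∧
    -- (q;q)_∞ (q²;q²)_∞, double series
    ((Summable fun p : ℕ+ × ℕ =>
        (-1 : ℂ) ^ ((p.1 : ℕ) + p.2 + 1) *
          q ^ ((p.1 : ℤ) * (p.1 + 1) / 2 + (p.2 : ℤ) ^ 2 - p.2 + 2 * p.1 * p.2 - 1 : ℤ) *
          (1 - q ^ (2 * p.2 + 1))) ∧
      HasSum
        (fun k : ℕ+ => ∑' n : ℕ,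
          (-1 : ℂ) ^ ((k : ℕ) + n + 1) *
            q ^ ((k : ℤ) * (k + 1) / 2 + (n : ℤ) ^ 2 - n + 2 * k * n - 1 : ℤ) *
            (1 - q ^ (2 * n + 1)))
        (qPochInf q q * qPochInf (q ^ 2) (q ^ 2))) ∧
    -- (q;q)_∞² (q;q²)_∞, Hecke-type sum
    HasSum
      (fun k : ℕ+ => ∑ n ∈ Finset.Icc (-(((k : ℤ) - 1) / 3)) ((k : ℤ) / 3),
        (-1 : ℂ) ^ (n + (k : ℤ) + 1 : ℤ) *
          q ^ (((k : ℤ) ^ 2 - k) / 2 - 3 * n ^ 2 + n : ℤ) * (1 - q ^ (k : ℕ)))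
      (qPochInf q q ^ 2 * qPochInf q (q ^ 2)) ∧
    -- (q;q)_∞ (q²;q²)_∞, Hecke-type sum
    HasSum
      (fun k : ℕ => ∑ n ∈ Finset.Icc (-((k : ℤ) / 2)) ((k : ℤ) / 2),
        (-1 : ℂ) ^ (n + (k : ℤ) : ℤ) * q ^ (((k : ℤ) ^ 2 + k) / 2 - n ^ 2 : ℤ))
      (qPochInf q q * qPochInf (q ^ 2) (q ^ 2)) := by
  refine ⟨sq_first_form hq, ?_, ?_, ?_, hasSum_hecke_cubic hq, hasSum_hecke_mixed hq⟩
  -- Here the outer index `k` is one more than the inner (theta) index of the basic series; the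
  -- fourth identity uses the same exchange.
  · refine summable_and_hasSum_of_hasSum (hasSum_sqTerm hq).prod_swap fun i n => ?_
    have hi := two_mul_choose_two i
    have hn := two_mul_choose_two n
    simp only [sqTerm, Nat.succPNat_coe, Nat.succ_eq_add_one, choose_two_succ]
    rw [zpow_eq_pow_of_eq (n := n.choose 2 + n + i.choose 2 + (2 * n + 2) * i)]
    · ring
    rw [ediv_two_eq (b := (i.choose 2 + 2 * i + 1 : ℤ)), ediv_two_eq (b := (n.choose 2 - n : ℤ))]
    · push_cast; ring
    · linarith
    · push_cast; linarith
  · refine summable_and_hasSum_of_hasSum (hasSum_cubicTerm hq) fun i n => ?_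
    have hi := two_mul_choose_two i
    have hn := two_mul_choose_two n
    simp only [cubicTerm, Nat.succPNat_coe, Nat.succ_eq_add_one, choose_two_succ]
    rw [zpow_eq_pow_of_eq (n := i.choose 2 + i + (3 * n.choose 2 + n) + 3 * (i + 1) * n),
      zpow_eq_pow_of_eq (n := 2 * i + 1)]
    · ring
    · push_cast; ring
    rw [ediv_two_eq (b := (i.choose 2 + i : ℤ)), ediv_two_eq (b := (3 * n.choose 2 + n : ℤ))]
    · push_cast; ring
    · linarith
    · push_cast; linarith
  · refine summable_and_hasSum_of_hasSum (hasSum_mixedTerm hq).prod_swap fun i n => ?_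
    have hi := two_mul_choose_two i
    simp only [mixedTerm, Nat.succPNat_coe, Nat.succ_eq_add_one]
    rw [zpow_eq_pow_of_eq (n := n ^ 2 + n + i.choose 2 + (2 * n + 2) * i)]
    · ring
    rw [ediv_two_eq (b := (i.choose 2 + 2 * i + 1 : ℤ))]
    · push_cast; ring
    · push_cast; linarith
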